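/- Let $C$ be a (coassociative, counital) coalgebra over a field $k$, with comultiplication $\Delta$. A right (resp. left) coideal of $C$ is a subspace $N \subseteq C$ with $\Delta(N) \subseteq N \otimes C$ (resp. $\Delta(N) \subseteq C \otimes N$), i.e. a right (resp. left) subcomodule of $C$; the right coideals form a lattice under intersection and sum, and so do the left coideals. A lattice is distributive if $a \wedge (b \vee c) = (a \wedge b) \vee (a \wedge c)$ for all its elements $a,b,c$. Call $C$ right (resp. left) distributive if its lattice of right (resp. left) coideals is distributive, and distributive if it is right distributive or left distributive. Call $C$ a right chain coalgebra if its right coideals are totally ordered by inclusion. The coproduct of a family of coalgebras is their direct sum with componentwise comultiplication and counit. Let $C^* = \mathrm{Hom}_k(C,k)$ be the dual algebra, with the convolution product $(f*g)(x) = \sum f(x_{(1)})\,g(x_{(2)})$ and unit the counit of $C$. A ring is left uniserial if its left ideals are totally ordered by inclusion, and left distributive if its lattice of left ideals is distributive. Then $C$ is right distributive if and only if it is left distributive, and the following conditions are equivalent: (a) $C$ is a distributive coalgebra; (b) $C$ is isomorphic, as a coalgebra, to a coproduct of right chain coalgebras; (c) $C^*$ is isomorphic, as a ring, to a direct product of left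 uniserial rings; (d) $C^*$ is a left distributive ring. -/

import Mathlib

open scoped TensorProduct

section Defs

universe u v w

/-- The distributive law `a ∧ (b ∨ c) = (a ∧ b) ∨ (a ∧ c)` in a lattice. -/
def IsDistributiveLattice (L : Type w) [Lattice L] : Prop :=
  ∀ a b c : L, a ⊓ (b ⊔ c) = (a ⊓ b) ⊔ (a ⊓ c)

/-- A lattice is a chain if any two of its elements are comparable. -/
def IsChainLattice (L : Type w) [Lattice L] : Prop :=
  ∀ a b : L, a ≤ b ∨ b ≤ a

section Tensor

variable {k : Type u} [Field k] {C : Type v} [AddCommGroup C] [Module k C]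

theorem range_rTensor_subtype_mono {N L : Submodule k C} (h : N ≤ L) :
    LinearMap.range (N.subtype.rTensor C) ≤ LinearMap.range (L.subtype.rTensor C) := by
  have e : N.subtype = L.subtype ∘ₗ Submodule.inclusion h := rfl
  rw [e, LinearMap.rTensor_comp]
  exact LinearMap.range_comp_le_range _ _

theorem range_lTensor_subtype_mono {N L : Submodule k C} (h : N ≤ L) :
    LinearMap.range (N.subtype.lTensor C) ≤ LinearMap.range (L.subtype.lTensor C) := by
  have e : N.subtype = L.subtype ∘ₗ Submodule.inclusion h := rfl
  rw [e, LinearMap.lTensor_comp]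
  exact LinearMap.range_comp_le_range _ _

theorem mem_range_rTensor_subtype_iff {N : Submodule k C} {z : C ⊗[k] C} :
    z ∈ LinearMap.range (N.subtype.rTensor C) ↔ N.mkQ.rTensor C z = 0 := by
  have h : Function.Exact N.subtype N.mkQ := by
    rw [LinearMap.exact_iff]; simp
  exact (rTensor_exact C h N.mkQ_surjective z).symm

/-- Over a field, `(N ⊗ C) ∩ (L ⊗ C) ⊆ (N ∩ L) ⊗ C` inside `C ⊗ C`. -/
theorem mem_range_rTensor_subtype_inf {N L : Submodule k C} {z : C ⊗[k] C}
    (hN : z ∈ LinearMap.range (N.subtype.rTensor C))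
    (hL : z ∈ LinearMap.range (L.subtype.rTensor C)) :
    z ∈ LinearMap.range ((N ⊓ L).subtype.rTensor C) := by
  rw [mem_range_rTensor_subtype_iff] at *
  let p : C ⧸ (N ⊓ L) →ₗ[k] C ⧸ N := Submodule.factor inf_le_left
  let q : C ⧸ (N ⊓ L) →ₗ[k] C ⧸ L := Submodule.factor inf_le_right
  have hinj : Function.Injective (p.prod q) := by
    rw [← LinearMap.ker_eq_bot, LinearMap.ker_eq_bot']
    intro m
    obtain ⟨x, rfl⟩ := Submodule.Quotient.mk_surjective _ m
    intro h
    have h1 : p (Submodule.Quotient.mk x) = 0 := congrArg Prod.fst h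
    have h2 : q (Submodule.Quotient.mk x) = 0 := congrArg Prod.snd h
    have h1' : x ∈ N := (Submodule.Quotient.mk_eq_zero N).1 h1
    have h2' : x ∈ L := (Submodule.Quotient.mk_eq_zero L).1 h2
    exact (Submodule.Quotient.mk_eq_zero _).2 ⟨h1', h2'⟩
  have hT := Module.Flat.rTensor_preserves_injective_linearMap (M := C) (p.prod q) hinj
  apply hT
  rw [map_zero]
  have hp : p ∘ₗ (N ⊓ L).mkQ = N.mkQ := rfl
  have hq : q ∘ₗ (N ⊓ L).mkQ = L.mkQ := rfl
  have key : (p.prod q).rTensor C =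
      (LinearMap.inl k _ _).rTensor C ∘ₗ p.rTensor C +
      (LinearMap.inr k _ _).rTensor C ∘ₗ q.rTensor C := by
    rw [← LinearMap.rTensor_comp, ← LinearMap.rTensor_comp, ← LinearMap.rTensor_add]
    congr 1
    ext x <;> simp
  rw [key, LinearMap.add_apply, LinearMap.comp_apply, LinearMap.comp_apply,
    ← LinearMap.comp_apply (p.rTensor C), ← LinearMap.comp_apply (q.rTensor C),
    ← LinearMap.rTensor_comp, ← LinearMap.rTensor_comp, hp, hq, hN, hL]
  simp

theorem mem_range_lTensor_subtype_iff {N : Submodule k C} {z : C ⊗[k] C} :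
    z ∈ LinearMap.range (N.subtype.lTensor C) ↔
      TensorProduct.comm k C C z ∈ LinearMap.range (N.subtype.rTensor C) := by
  constructor
  · rintro ⟨y, rfl⟩
    exact ⟨TensorProduct.comm k C N y, by rw [LinearMap.rTensor_comm]⟩
  · rintro ⟨y, hy⟩
    refine ⟨TensorProduct.comm k N C y, ?_⟩
    apply (TensorProduct.comm k C C).injective
    rw [← hy]
    have := LinearMap.rTensor_comm N.subtype (TensorProduct.comm k N C y)
    rw [TensorProduct.comm_comm] at this
    exact this.symm

theorem mem_range_lTensor_subtype_inf {N L : Submodule k C} {z : C ⊗[k] C}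
    (hN : z ∈ LinearMap.range (N.subtype.lTensor C))
    (hL : z ∈ LinearMap.range (L.subtype.lTensor C)) :
    z ∈ LinearMap.range ((N ⊓ L).subtype.lTensor C) := by
  rw [mem_range_lTensor_subtype_iff] at *
  exact mem_range_rTensor_subtype_inf hN hL

end Tensor

section Coideals

variable (k : Type u) [Field k] (C : Type v) [AddCommGroup C] [Module k C] [Coalgebra k C]

/-- The lattice of right coideals of `C`, i.e. of right subcomodules of `C`: the subspaces `N` with
`Δ(N) ⊆ N ⊗ C`, with sum and intersection. -/
def rightCoideals : Sublattice (Submodule k C) where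
  carrier := {N | ∀ x ∈ N, Coalgebra.comul (R := k) x ∈ LinearMap.range (N.subtype.rTensor C)}
  supClosed' := by
    intro N hN L hL x hx
    obtain ⟨y, hy, z, hz, rfl⟩ := Submodule.mem_sup.1 hx
    rw [map_add]
    exact add_mem (range_rTensor_subtype_mono le_sup_left (hN y hy))
      (range_rTensor_subtype_mono le_sup_right (hL z hz))
  infClosed' := by
    intro N hN L hL x hx
    exact mem_range_rTensor_subtype_inf (hN x hx.1) (hL x hx.2)

/-- The lattice of left coideals of `C`, i.e. of left subcomodules of `C`: the subspaces `N` with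
`Δ(N) ⊆ C ⊗ N`, with sum and intersection. -/
def leftCoideals : Sublattice (Submodule k C) where
  carrier := {N | ∀ x ∈ N, Coalgebra.comul (R := k) x ∈ LinearMap.range (N.subtype.lTensor C)}
  supClosed' := by
    intro N hN L hL x hx
    obtain ⟨y, hy, z, hz, rfl⟩ := Submodule.mem_sup.1 hx
    rw [map_add]
    exact add_mem (range_lTensor_subtype_mono le_sup_left (hN y hy))
      (range_lTensor_subtype_mono le_sup_right (hL z hz))
  infClosed' := by
    intro N hN L hL x hx
    exact mem_range_lTensor_subtype_inf (hN x hx.1) (hL x hx.2)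

/-- `C` is distributive as a right comodule over itself. -/
def IsRightDistributiveCoalgebra : Prop := IsDistributiveLattice (rightCoideals k C)

/-- `C` is distributive as a left comodule over itself. -/
def IsLeftDistributiveCoalgebra : Prop := IsDistributiveLattice (leftCoideals k C)

/-- A coalgebra is distributive if it is distributive as a left or as a right comodule. -/
def IsDistributiveCoalgebra : Prop :=
  IsRightDistributiveCoalgebra k C ∨ IsLeftDistributiveCoalgebra k C

/-- A right chain coalgebra: `C` is uniserial as a right comodule over itself. -/
def IsRightChainCoalgebra : Prop := IsChainLattice (rightCoideals k C)

/-- `C` is isomorphic, as a coalgebra, to the coproduct of a family of right chain coalgebras.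
The coproduct is the direct sum with componentwise comultiplication and counit. -/
def IsCoproductOfRightChainCoalgebras : Prop :=
  ∃ (ι : Type v) (_ : DecidableEq ι) (D : ι → Type v) (_ : ∀ i, AddCommGroup (D i))
    (_ : ∀ i, Module k (D i)) (_ : ∀ i, Coalgebra k (D i)),
    (∀ i, IsRightChainCoalgebra k (D i)) ∧ Nonempty (C ≃ₗc[k] (Π₀ i, D i))

/-- The dual algebra `C^*`, the linear forms on `C` with the convolution product
`(f * g)(x) = ∑ f(x₁) g(x₂)` and unit `ε`. -/
abbrev DualAlgebra : Type (max u v) := WithConv (C →ₗ[k] k)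

end Coideals

section Rings

/-- A ring is left distributive if its lattice of left ideals is distributive. -/
def IsLeftDistributiveRing (R : Type w) [Ring R] : Prop := IsDistributiveLattice (Ideal R)

/-- A ring is left uniserial if its left ideals form a chain. -/
def IsLeftUniserialRing (R : Type w) [Ring R] : Prop := IsChainLattice (Ideal R)

/-- A ring isomorphic to a direct product of left uniserial rings. -/
def IsProductOfLeftUniserialRings (A : Type w) [Ring A] : Prop :=
  ∃ (ι : Type w) (R : ι → Type w) (_ : ∀ i, Ring (R i)),
    (∀ i, IsLeftUniserialRing (R i)) ∧ Nonempty (A ≃+* (∀ i, R i))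

end Rings

end Defs

open Module

universe u v


/-! Linear forms act on `C` by `f ⇀ x = ∑ f(x₂) x₁` and `x ↼ f = ∑ f(x₁) x₂`. These actions commute,
are locally finite, and are transposed: `g (f ⇀ x) = f (x ↼ g)`. Right coideals are the subspaces
stable under the first, left coideals those stable under the second, so most of the argument is
linear algebra for such a pair (`IsHitPair`).

Symmetry: each `R g` is linear for the `L` action, and a graph argument shows that in a distributive
lattice it preserves finite dimensional `L`-stable subspaces. As `L`- and `R`-orbits of a vector
have equal dimension, the two lattices coincide (`IsHitPair.isStable_iff`).

(a) to (b): Fitting's lemma makes a finite dimensional indecomposable stable subspace a chain.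
Chains that meet nontrivially have a chain as their sum, so the maximal chains are independent; they
span `C` by local finiteness, and being two-sided coideals they are subcoalgebras.

(b) to (c): dualizing turns the coproduct into a product, and in the dual of a right chain coalgebra
left divisibility is governed by kernels, which are comparable. (c) to (d): an elementwise criterion
for distributivity is checked coordinatewise. (d) to (a): annihilators embed left coideals into left
ideals, reversing order and exchanging sums with intersections. -/

/-- A subspace stable under a family of endomorphisms indexed by linear forms. -/
def IsStable {k V : Type*} [Field k] [AddCommGroup V] [Module k V]
    (L : Dual k V →ₗ[k] V →ₗ[k] V) (N : Submodule k V) : Prop :=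
  ∀ f, ∀ x ∈ N, L f x ∈ N

/-- Two commuting locally finite families of endomorphisms of `V` indexed by the linear forms on
`V`, transposed to each other, the first one closed under composition and containing the
identity. -/
structure IsHitPair {k V : Type*} [Field k] [AddCommGroup V] [Module k V]
    (L R : Dual k V →ₗ[k] V →ₗ[k] V) : Prop where
  one : ∃ e, ∀ x, L e x = x
  mul : ∀ f g, ∃ h, ∀ x, L f (L g x) = L h x
  comm : ∀ f g x, L f (R g x) = R g (L f x)
  pair : ∀ (f g : Dual k V) (x : V), g (L f x) = f (R g x)
  fin : ∀ x, FiniteDimensional k (LinearMap.range (L.flip x))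

/-! ### Commuting transposed actions and their stable subspaces -/

section Stable

variable {k V : Type*} [Field k] [AddCommGroup V] [Module k V]
  {L R : Dual k V →ₗ[k] V →ₗ[k] V}

/-- The subspace generated by `x` under the family `L`. -/
def orbitSpan (L : Dual k V →ₗ[k] V →ₗ[k] V) (x : V) : Submodule k V :=
  LinearMap.range (L.flip x)

theorem mem_orbitSpan {x y : V} : y ∈ orbitSpan L x ↔ ∃ f, L f x = y := Iff.rfl

theorem IsStable.sup {N P : Submodule k V} (hN : IsStable L N) (hP : IsStable L P) :
    IsStable L (N ⊔ P) := by
  intro f x hx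
  obtain ⟨y, hy, z, hz, rfl⟩ := Submodule.mem_sup.1 hx
  rw [map_add]
  exact Submodule.add_mem_sup (hN f y hy) (hP f z hz)

theorem IsStable.inf {N P : Submodule k V} (hN : IsStable L N) (hP : IsStable L P) :
    IsStable L (N ⊓ P) :=
  fun f x hx => ⟨hN f x hx.1, hP f x hx.2⟩

theorem IsStable.bot : IsStable L ⊥ := by
  intro f x hx
  rw [Submodule.mem_bot] at hx
  simp [hx]

theorem IsStable.orbitSpan_le {N : Submodule k V} (hN : IsStable L N) {x : V} (hx : x ∈ N) :
    orbitSpan L x ≤ N := by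
  rintro _ ⟨f, rfl⟩
  exact hN f x hx

namespace IsHitPair

theorem isStable_orbitSpan (h : IsHitPair L R) (x : V) : IsStable L (orbitSpan L x) := by
  rintro f _ ⟨g, rfl⟩
  obtain ⟨l, hl⟩ := h.mul f g
  exact ⟨l, (hl x).symm⟩

theorem self_mem_orbitSpan (h : IsHitPair L R) (x : V) : x ∈ orbitSpan L x := by
  obtain ⟨e, he⟩ := h.one
  exact ⟨e, he x⟩

theorem isStable_map (h : IsHitPair L R) {N : Submodule k V} (hN : IsStable L N) (g : Dual k V) :
    IsStable L (N.map (R g)) := by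
  rintro f _ ⟨x, hx, rfl⟩
  exact ⟨L f x, hN f x hx, (h.comm f g x).symm⟩

/-- By `pair`, the transpose of `f ↦ L f x` is `g ↦ R g x` followed by the injection of `V` into its
bidual, and a finite rank map has the rank of its transpose. -/
theorem finrank_orbitSpan_eq (h : IsHitPair L R) (x : V) :
    finrank k (orbitSpan R x) = finrank k (orbitSpan L x) := by
  have := h.fin x
  have e : (L.flip x).dualMap = (Dual.eval k V) ∘ₗ (R.flip x) := by
    ext g f
    exact h.pair f g x
  have h1 := LinearMap.finrank_range_dualMap_eq_finrank_range (L.flip x)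
  rw [e, LinearMap.range_comp] at h1
  rw [orbitSpan, orbitSpan, ← h1]
  exact (LinearEquiv.finrank_eq (Submodule.equivMapOfInjective _
    (eval_apply_injective k (V := V)) _))

/-- If the lattice of stable subspaces is distributive, a finite dimensional `L`-stable subspace is
`R`-stable. -/
theorem isStable_of_finiteDimensional (h : IsHitPair L R)
    (dist : ∀ a b c, IsStable L a → IsStable L b → IsStable L c →
      a ⊓ (b ⊔ c) ≤ (a ⊓ b) ⊔ (a ⊓ c)) (n : ℕ) :
    ∀ N : Submodule k V, FiniteDimensional k N → finrank k N = n → IsStable L N →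
      IsStable R N := by
  induction n using Nat.strong_induction_on with
  | _ n ih =>
  intro N hfin hn hN g
  let P : Submodule k V := N ⊓ N.comap (R g)
  have hPs : IsStable L P := by
    refine hN.inf ?_
    intro f x hx
    change R g (L f x) ∈ N
    rw [← h.comm]
    exact hN f _ hx
  by_cases hPN : P = N
  · intro x hx
    rw [← hPN] at hx
    exact hx.2
  have hlt : P < N := lt_of_le_of_ne inf_le_left hPN
  have hPfin : FiniteDimensional k P := Submodule.finiteDimensional_of_le hlt.le
  have hP : IsStable R P := ih _ (hn ▸ Submodule.finrank_lt_finrank_of_lt hlt) P hPfin rfl hPs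
  -- The graph of `R g` over `N`. Modulo `P` it meets both `N` and the image of `N` trivially, yet
  -- it lies in their sum; distributivity then forces it into `P`.
  let G : Submodule k V := N.map (LinearMap.id + R g)
  have hG : IsStable L (G ⊔ P) := by
    refine IsStable.sup ?_ hPs
    rintro f _ ⟨x, hx, rfl⟩
    refine ⟨L f x, hN f x hx, ?_⟩
    simp [h.comm]
  have hQ : IsStable L (N.map (R g) ⊔ P) := (h.isStable_map hN g).sup hPs
  have key := dist _ _ _ hG hN hQ
  have h1 : (G ⊔ P) ⊓ N ≤ P := by
    rintro z ⟨hz, hzN⟩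
    obtain ⟨_, ⟨n, hn, rfl⟩, p, hp, rfl⟩ := Submodule.mem_sup.1 hz
    have : R g n ∈ N := by
      have := N.sub_mem (N.sub_mem hzN (hlt.le hp)) hn
      simpa using this
    refine P.add_mem ?_ hp
    exact P.add_mem ⟨hn, this⟩ (hP g n ⟨hn, this⟩)
  have h2 : (G ⊔ P) ⊓ (N.map (R g) ⊔ P) ≤ P := by
    rintro z ⟨hz, hzQ⟩
    obtain ⟨_, ⟨n, hn, rfl⟩, p, hp, rfl⟩ := Submodule.mem_sup.1 hz
    obtain ⟨_, ⟨m, hm, rfl⟩, q, hq, hmq⟩ := Submodule.mem_sup.1 hzQ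
    -- Comparing the two expressions of `z` shows that `R g` sends `m - n` into `N`, so `m - n` lies
    -- in `P`, and so does `n` because `P` is `R`-stable.
    have hn' : n = R g (m - n) + (q - p) := by
      have : n + R g n + p = R g m + q := hmq.symm
      rw [map_sub]
      have h3 : R g n = R g m + q - n - p := by rw [← this]; abel
      rw [h3]; abel
    have hmem : R g (m - n) ∈ N := by
      have : R g (m - n) = n - (q - p) := eq_sub_of_add_eq hn'.symm
      rw [this]
      exact N.sub_mem hn (N.sub_mem (hlt.le hq) (hlt.le hp))
    have hmn : m - n ∈ P := ⟨N.sub_mem hm hn, hmem⟩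
    have hnP : n ∈ P := by
      rw [hn']
      exact P.add_mem (hP g _ hmn) (P.sub_mem hq hp)
    exact P.add_mem (P.add_mem hnP (hP g _ hnP)) hp
  intro x hx
  have hxG : x + R g x ∈ G ⊔ P := le_sup_left (a := G) ⟨x, hx, rfl⟩
  have : x + R g x ∈ P := by
    refine (key.trans (sup_le h1 h2)) ⟨hxG, ?_⟩
    exact Submodule.add_mem_sup hx (Submodule.mem_sup_left ⟨x, hx, rfl⟩)
  have := N.sub_mem (hlt.le this) hx
  simpa using this

/-- If the lattice of `L`-stable subspaces is distributive, it is also the lattice of `R`-stable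
subspaces. -/
theorem isStable_iff (h : IsHitPair L R)
    (dist : ∀ a b c, IsStable L a → IsStable L b → IsStable L c →
      a ⊓ (b ⊔ c) ≤ (a ⊓ b) ⊔ (a ⊓ c)) (N : Submodule k V) :
    IsStable L N ↔ IsStable R N := by
  have horb (x : V) : IsStable R (orbitSpan L x) :=
    h.isStable_of_finiteDimensional dist _ _ (h.fin x) rfl (h.isStable_orbitSpan x)
  constructor
  · intro hN g x hx
    exact hN.orbitSpan_le hx (horb x g x (h.self_mem_orbitSpan x))
  · intro hN f x hx
    have := h.fin x
    have hle : orbitSpan R x ≤ orbitSpan L x := (horb x).orbitSpan_le (h.self_mem_orbitSpan x)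
    have heq : orbitSpan R x = orbitSpan L x :=
      Submodule.eq_of_le_of_finrank_eq (S₂ := LinearMap.range (L.flip x)) hle
        (h.finrank_orbitSpan_eq x)
    refine hN.orbitSpan_le hx ?_
    rw [heq]
    exact ⟨f, rfl⟩

end IsHitPair

end Stable

theorem eq_of_forall_dual {k V : Type*} [Field k] [AddCommGroup V] [Module k V]
    {x y : V} (h : ∀ g : Dual k V, g x = g y) : x = y := by
  rw [← sub_eq_zero, ← Module.forall_dual_apply_eq_zero_iff k]
  intro g
  rw [map_sub, h, sub_self]

theorem eq_zero_of_forall_lTensor {k C M : Type*} [Field k] [AddCommGroup C]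
    [Module k C] [AddCommGroup M] [Module k M] {z : M ⊗[k] C}
    (h : ∀ f : Dual k C, f.lTensor M z = 0) : z = 0 := by
  classical
  let b := Basis.ofVectorSpace k C
  apply (TensorProduct.equivFinsuppOfBasisRight (M := M) b).injective
  ext i
  rw [TensorProduct.equivFinsuppOfBasisRight_apply, h]
  simp

/-! ### The two actions of the dual on a coalgebra -/

section Hit

variable (k : Type*) [Field k] (C : Type*) [AddCommGroup C] [Module k C] [Coalgebra k C]

/-- The left action `f ⇀ x = ∑ f(x₂) x₁` of linear forms on a coalgebra. -/
noncomputable def hitL : Dual k C →ₗ[k] C →ₗ[k] C :=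
  ((TensorProduct.rid k C).toLinearMap.compRight k).comp
    ((LinearMap.lcomp k (C ⊗[k] k) (Coalgebra.comul (R := k) (A := C))).comp
      (LinearMap.lTensorHom (R := k) C))

/-- The right action `x ↼ f = ∑ f(x₁) x₂` of linear forms on a coalgebra. -/
noncomputable def hitR : Dual k C →ₗ[k] C →ₗ[k] C :=
  ((TensorProduct.lid k C).toLinearMap.compRight k).comp
    ((LinearMap.lcomp k (k ⊗[k] C) (Coalgebra.comul (R := k) (A := C))).comp
      (LinearMap.rTensorHom (R := k) C))

variable {k C}

theorem hitL_apply (f : Dual k C) (x : C) :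
    hitL k C f x = TensorProduct.rid k C (f.lTensor C (Coalgebra.comul x)) := rfl

theorem hitR_apply (f : Dual k C) (x : C) :
    hitR k C f x = TensorProduct.lid k C (f.rTensor C (Coalgebra.comul x)) := rfl

theorem apply_hitL (f g : Dual k C) (x : C) :
    g (hitL k C f x) = (WithConv.toConv g * WithConv.toConv f) x := by
  rw [hitL_apply, LinearMap.convMul_apply]
  induction Coalgebra.comul (R := k) x with
  | zero => simp
  | tmul a b => simp [mul_comm]
  | add a b ha hb => simp only [map_add, ha, hb]

theorem apply_hitR (f g : Dual k C) (x : C) :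
    g (hitR k C f x) = (WithConv.toConv f * WithConv.toConv g) x := by
  rw [hitR_apply, LinearMap.convMul_apply]
  induction Coalgebra.comul (R := k) x with
  | zero => simp
  | tmul a b => simp
  | add a b ha hb => simp only [map_add, ha, hb]

theorem hitL_hitL (f g : Dual k C) (x : C) :
    hitL k C f (hitL k C g x) =
      hitL k C (WithConv.toConv f * WithConv.toConv g).ofConv x := by
  refine eq_of_forall_dual (k := k) fun h => ?_
  simp only [apply_hitL, WithConv.toConv_ofConv, mul_assoc]

theorem hitR_hitR (f g : Dual k C) (x : C) :
    hitR k C f (hitR k C g x) =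
      hitR k C (WithConv.toConv g * WithConv.toConv f).ofConv x := by
  refine eq_of_forall_dual (k := k) fun h => ?_
  simp only [apply_hitR, WithConv.toConv_ofConv, mul_assoc]

theorem hitL_hitR (f g : Dual k C) (x : C) :
    hitL k C f (hitR k C g x) = hitR k C g (hitL k C f x) := by
  refine eq_of_forall_dual (k := k) fun h => ?_
  simp only [apply_hitL, apply_hitR, WithConv.toConv_ofConv, mul_assoc]

theorem hitL_counit (x : C) : hitL k C Coalgebra.counit x = x := by
  rw [hitL_apply, Coalgebra.lTensor_counit_comul]
  simp

theorem hitR_counit (x : C) : hitR k C Coalgebra.counit x = x := by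
  rw [hitR_apply, Coalgebra.rTensor_counit_comul]
  simp

theorem finiteDimensional_range_flip_hitL (x : C) :
    FiniteDimensional k (LinearMap.range ((hitL k C).flip x)) := by
  obtain ⟨s, hs⟩ := TensorProduct.exists_finset (R := k) (Coalgebra.comul (R := k) x)
  have := FiniteDimensional.span_of_finite k (s.finite_toSet.image fun i : C × C => i.1)
  refine Submodule.finiteDimensional_of_le
    (S₂ := Submodule.span k ((fun i : C × C => i.1) '' s)) ?_
  rintro _ ⟨f, rfl⟩
  rw [LinearMap.flip_apply, hitL_apply, hs]
  simp only [map_sum, LinearMap.lTensor_tmul, TensorProduct.rid_tmul]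
  exact Submodule.sum_mem _ fun i hi =>
    Submodule.smul_mem _ _ (Submodule.subset_span ⟨i, hi, rfl⟩)

theorem finiteDimensional_range_flip_hitR (x : C) :
    FiniteDimensional k (LinearMap.range ((hitR k C).flip x)) := by
  obtain ⟨s, hs⟩ := TensorProduct.exists_finset (R := k) (Coalgebra.comul (R := k) x)
  have := FiniteDimensional.span_of_finite k (s.finite_toSet.image fun i : C × C => i.2)
  refine Submodule.finiteDimensional_of_le
    (S₂ := Submodule.span k ((fun i : C × C => i.2) '' s)) ?_
  rintro _ ⟨f, rfl⟩
  rw [LinearMap.flip_apply, hitR_apply, hs]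
  simp only [map_sum, LinearMap.rTensor_tmul, TensorProduct.lid_tmul]
  exact Submodule.sum_mem _ fun i hi =>
    Submodule.smul_mem _ _ (Submodule.subset_span ⟨i, hi, rfl⟩)

variable (k C) in
theorem isHitPair_hitL_hitR : IsHitPair (hitL k C) (hitR k C) where
  one := ⟨_, hitL_counit⟩
  mul f g := ⟨_, hitL_hitL f g⟩
  comm := hitL_hitR
  pair f g x := by rw [apply_hitL, apply_hitR]
  fin := finiteDimensional_range_flip_hitL

variable (k C) in
theorem isHitPair_hitR_hitL : IsHitPair (hitR k C) (hitL k C) where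
  one := ⟨_, hitR_counit⟩
  mul f g := ⟨_, hitR_hitR f g⟩
  comm f g x := (hitL_hitR g f x).symm
  pair f g x := by rw [apply_hitL, apply_hitR]
  fin := finiteDimensional_range_flip_hitR

/-- Over a field, a tensor in `(C ⧸ N) ⊗ C` is zero as soon as all linear forms on the second factor
kill it. Applied to the image of `Δ x`, this tests `Δ x ∈ N ⊗ C` by the vectors `f ⇀ x`. -/
theorem mem_rightCoideals_iff {N : Submodule k C} :
    N ∈ rightCoideals k C ↔ IsStable (hitL k C) N := by
  have key (f : Dual k C) (x : C) : (hitL k C f x ∈ N) ↔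
      f.lTensor (C ⧸ N) (N.mkQ.rTensor C (Coalgebra.comul x)) = 0 := by
    rw [← Submodule.Quotient.mk_eq_zero, ← Submodule.mkQ_apply, hitL_apply,
      ← (TensorProduct.rid k (C ⧸ N)).map_eq_zero_iff]
    refine Eq.congr ?_ rfl
    induction Coalgebra.comul (R := k) x with
    | zero => simp
    | tmul a b => simp
    | add a b ha hb => simp only [map_add, ha, hb]
  constructor
  · intro hN f x hx
    rw [key, mem_range_rTensor_subtype_iff.1 (hN x hx), map_zero]
  · intro hN x hx
    rw [mem_range_rTensor_subtype_iff]
    exact eq_zero_of_forall_lTensor fun f => (key f x).1 (hN f x hx)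

theorem mem_leftCoideals_iff {N : Submodule k C} :
    N ∈ leftCoideals k C ↔ IsStable (hitR k C) N := by
  have key (f : Dual k C) (x : C) : (hitR k C f x ∈ N) ↔
      f.lTensor (C ⧸ N) (N.mkQ.rTensor C (TensorProduct.comm k C C (Coalgebra.comul x))) = 0 := by
    rw [← Submodule.Quotient.mk_eq_zero, ← Submodule.mkQ_apply, hitR_apply,
      ← (TensorProduct.rid k (C ⧸ N)).map_eq_zero_iff]
    refine Eq.congr ?_ rfl
    induction Coalgebra.comul (R := k) x with
    | zero => simp
    | tmul a b => simp
    | add a b ha hb => simp only [map_add, ha, hb]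
  constructor
  · intro hN f x hx
    rw [key, mem_range_rTensor_subtype_iff.1 (mem_range_lTensor_subtype_iff.1 (hN x hx)), map_zero]
  · intro hN x hx
    rw [mem_range_lTensor_subtype_iff, mem_range_rTensor_subtype_iff]
    exact eq_zero_of_forall_lTensor fun f => (key f x).1 (hN f x hx)

/-! ### Left-right symmetry of distributivity -/

theorem isDistributiveLattice_sublattice_iff {L : Type*} [Lattice L] {S : Sublattice L} :
    IsDistributiveLattice S ↔ ∀ a b c, a ∈ S → b ∈ S → c ∈ S → a ⊓ (b ⊔ c) ≤ (a ⊓ b) ⊔ (a ⊓ c) := by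
  constructor
  · intro h a b c ha hb hc
    exact (congrArg Subtype.val (h ⟨a, ha⟩ ⟨b, hb⟩ ⟨c, hc⟩)).le
  · rintro h ⟨a, ha⟩ ⟨b, hb⟩ ⟨c, hc⟩
    apply Subtype.ext
    exact le_antisymm (h a b c ha hb hc) le_inf_sup

theorem IsChainLattice.isDistributiveLattice {L : Type*} [Lattice L] (h : IsChainLattice L) :
    IsDistributiveLattice L := by
  intro a b c
  rcases h b c with hbc | hbc
  · rw [sup_eq_right.2 hbc, sup_eq_right.2 (inf_le_inf_left a hbc)]
  · rw [sup_eq_left.2 hbc, sup_eq_left.2 (inf_le_inf_left a hbc)]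

theorem leftCoideals_eq_rightCoideals_of_right (h : IsRightDistributiveCoalgebra k C) :
    leftCoideals k C = rightCoideals k C := by
  refine SetLike.ext fun N => ?_
  rw [mem_leftCoideals_iff, mem_rightCoideals_iff]
  refine ((isHitPair_hitL_hitR k C).isStable_iff (fun a b c ha hb hc => ?_) N).symm
  simp only [← mem_rightCoideals_iff] at ha hb hc
  exact isDistributiveLattice_sublattice_iff.1 h a b c ha hb hc

theorem leftCoideals_eq_rightCoideals_of_left (h : IsLeftDistributiveCoalgebra k C) :
    leftCoideals k C = rightCoideals k C := by
  refine SetLike.ext fun N => ?_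
  rw [mem_leftCoideals_iff, mem_rightCoideals_iff]
  refine (isHitPair_hitR_hitL k C).isStable_iff (fun a b c ha hb hc => ?_) N
  simp only [← mem_leftCoideals_iff] at ha hb hc
  exact isDistributiveLattice_sublattice_iff.1 h a b c ha hb hc

variable (k C) in
theorem isRightDistributiveCoalgebra_iff_isLeftDistributiveCoalgebra :
    IsRightDistributiveCoalgebra k C ↔ IsLeftDistributiveCoalgebra k C := by
  constructor
  · intro h
    rwa [IsLeftDistributiveCoalgebra, leftCoideals_eq_rightCoideals_of_right h]
  · intro h
    rwa [IsRightDistributiveCoalgebra, ← leftCoideals_eq_rightCoideals_of_left h]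

/-! ### Ideals of the dual algebra -/

theorem mul_apply_eq_hitL (f g : DualAlgebra k C) (x : C) :
    (f * g) x = f (hitL k C g.ofConv x) :=
  (apply_hitL g.ofConv f.ofConv x).symm

/-- The kernel of the left action of a linear form is a left coideal. -/
theorem isStable_ker_hitL (f : Dual k C) : IsStable (hitR k C) (LinearMap.ker (hitL k C f)) := by
  intro g x hx
  rw [LinearMap.mem_ker] at hx ⊢
  rw [hitL_hitR, hx, map_zero]

/-- Since `l * g = l ∘ hitL g`, the form `f` is a left multiple of `g` as soon as it vanishes on the
kernel of `hitL g`. Such kernels are left coideals, hence right coideals by symmetry, hence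
comparable. -/
theorem isLeftUniserialRing_dualAlgebra (h : IsRightChainCoalgebra k C) :
    IsLeftUniserialRing (DualAlgebra k C) := by
  have hdist : IsRightDistributiveCoalgebra k C := IsChainLattice.isDistributiveLattice h
  have hlr := leftCoideals_eq_rightCoideals_of_right hdist
  have hmul (f g : DualAlgebra k C)
      (hfg : LinearMap.ker (hitL k C g.ofConv) ≤ LinearMap.ker (hitL k C f.ofConv)) :
      ∃ l, f = l * g := by
    have hker : LinearMap.ker (hitL k C g.ofConv) ≤ LinearMap.ker f.ofConv := by
      intro x hx
      have := LinearMap.mem_ker.1 (hfg hx)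
      rw [LinearMap.mem_ker]
      -- The counit recovers `f` from its action: `f x = ε (f ⇀ x)`.
      have h1 := mul_apply_eq_hitL 1 f x
      rw [one_mul, this] at h1
      simpa using h1
    have hf : f.ofConv ∈ LinearMap.range (hitL k C g.ofConv).dualMap := by
      rw [LinearMap.range_dualMap_eq_dualAnnihilator_ker, Submodule.mem_dualAnnihilator]
      exact fun x hx => hker hx
    obtain ⟨l, hl⟩ := hf
    refine ⟨WithConv.toConv l, WithConv.ext ?_⟩
    rw [← hl]
    ext x
    exact apply_hitL g.ofConv l x
  have hcomp (f g : DualAlgebra k C) : (∃ l, f = l * g) ∨ ∃ l, g = l * f := by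
    have hf := isStable_ker_hitL f.ofConv
    have hg := isStable_ker_hitL g.ofConv
    rw [← mem_leftCoideals_iff, hlr] at hf hg
    rcases h ⟨_, hf⟩ ⟨_, hg⟩ with hle | hle
    · exact Or.inr (hmul g f hle)
    · exact Or.inl (hmul f g hle)
  intro I J
  by_contra! hIJ
  obtain ⟨f, hfI, hfJ⟩ := SetLike.not_le_iff_exists.1 hIJ.1
  obtain ⟨g, hgJ, hgI⟩ := SetLike.not_le_iff_exists.1 hIJ.2
  rcases hcomp f g with ⟨l, rfl⟩ | ⟨l, rfl⟩
  · exact hfJ (J.mul_mem_left l hgJ)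
  · exact hgI (I.mul_mem_left l hfI)

/-- The linear forms vanishing on a left coideal form a left ideal of the dual algebra. -/
def annihilatorIdeal (N : Submodule k C) (hN : N ∈ leftCoideals k C) : Ideal (DualAlgebra k C) where
  carrier := {f | f.ofConv ∈ N.dualAnnihilator}
  add_mem' hf hg := N.dualAnnihilator.add_mem hf hg
  zero_mem' := N.dualAnnihilator.zero_mem
  smul_mem' g f hf := by
    refine (Submodule.mem_dualAnnihilator _).2 fun x hx => ?_
    have := apply_hitR g.ofConv f.ofConv x
    refine this.symm.trans ?_
    exact (Submodule.mem_dualAnnihilator _).1 hf _ (mem_leftCoideals_iff.1 hN _ _ hx)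

theorem mem_annihilatorIdeal {N : Submodule k C} {hN : N ∈ leftCoideals k C}
    {f : DualAlgebra k C} : f ∈ annihilatorIdeal N hN ↔ f.ofConv ∈ N.dualAnnihilator := Iff.rfl

/-- Annihilators over a field turn sums into intersections and finite intersections into sums, and
they reflect inclusions. The law for coideals thus becomes the dual distributive law for left
ideals. -/
theorem isLeftDistributiveCoalgebra_of_dualAlgebra
    (h : IsLeftDistributiveRing (DualAlgebra k C)) : IsLeftDistributiveCoalgebra k C := by
  refine isDistributiveLattice_sublattice_iff.2 fun a b c ha hb hc => ?_
  rw [← Subspace.dualAnnihilator_le_dualAnnihilator_iff]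
  intro f hf
  rw [Submodule.dualAnnihilator_sup_eq, Subspace.dualAnnihilator_inf_eq,
    Subspace.dualAnnihilator_inf_eq] at hf
  rw [Subspace.dualAnnihilator_inf_eq, Submodule.dualAnnihilator_sup_eq]
  set A := annihilatorIdeal a ha
  set B := annihilatorIdeal b hb
  set D := annihilatorIdeal c hc
  have hsup (I J : Submodule k C) (hI : I ∈ leftCoideals k C) (hJ : J ∈ leftCoideals k C)
      (g : DualAlgebra k C) :
      g ∈ annihilatorIdeal I hI ⊔ annihilatorIdeal J hJ ↔
        g.ofConv ∈ I.dualAnnihilator ⊔ J.dualAnnihilator := by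
    simp only [Submodule.mem_sup, mem_annihilatorIdeal]
    constructor
    · rintro ⟨y, hy, z, hz, rfl⟩
      exact ⟨_, hy, _, hz, rfl⟩
    · rintro ⟨y, hy, z, hz, e⟩
      exact ⟨WithConv.toConv y, hy, WithConv.toConv z, hz, WithConv.ofConv_injective e⟩
  have hf' : WithConv.toConv f ∈ (A ⊔ B) ⊓ (A ⊔ D) :=
    ⟨(hsup a b ha hb (WithConv.toConv f)).2 hf.1, (hsup a c ha hc (WithConv.toConv f)).2 hf.2⟩
  -- In any lattice the distributive law implies its dual.
  have hlat : (A ⊔ B) ⊓ (A ⊔ D) ≤ A ⊔ (B ⊓ D) := by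
    rw [h (A ⊔ B) A D, inf_comm (A ⊔ B) D, h D A B]
    refine sup_le (inf_le_right.trans le_sup_left) (sup_le (inf_le_right.trans le_sup_left) ?_)
    rw [inf_comm D B]
    exact le_sup_right
  obtain ⟨y, hy, z, hz, hyz⟩ := Submodule.mem_sup.1 (hlat hf')
  exact Submodule.mem_sup.2 ⟨y.ofConv, hy, z.ofConv, ⟨hz.1, hz.2⟩, congrArg WithConv.ofConv hyz⟩

end Hit

/-! ### Left distributive rings and products of uniserial rings -/

theorem isLeftDistributiveRing_of_forall {R : Type*} [Ring R]
    (h : ∀ x y : R, ∃ r s u v : R, r + s = 1 ∧ r * x = u * y ∧ s * y = v * x) :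
    IsLeftDistributiveRing R := by
  intro a b c
  refine le_antisymm ?_ le_inf_sup
  rintro x ⟨hxa, hx⟩
  obtain ⟨y, hy, z, hz, rfl⟩ := Submodule.mem_sup.1 hx
  obtain ⟨r, s, u, v, hrs, hu, hv⟩ := h y z
  -- The partition `r + s = 1` splits the element: `s` moves `z` into `R y`, and `r` moves `y` into
  -- `R z`.
  have e : y + z = s * (y + z) + r * (y + z) := by rw [← add_mul, add_comm s, hrs, one_mul]
  have h1 : s * (y + z) ∈ a ⊓ b := by
    refine ⟨a.mul_mem_left s hxa, ?_⟩
    rw [mul_add, hv]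
    exact b.add_mem (b.mul_mem_left _ hy) (b.mul_mem_left _ hy)
  have h2 : r * (y + z) ∈ a ⊓ c := by
    refine ⟨a.mul_mem_left r hxa, ?_⟩
    rw [mul_add, hu]
    exact c.add_mem (c.mul_mem_left _ hz) (c.mul_mem_left _ hz)
  rw [e]
  exact Submodule.add_mem_sup h1 h2

theorem IsLeftUniserialRing.exists_mul_eq {R : Type*} [Ring R] (h : IsLeftUniserialRing R)
    (x y : R) : (∃ u, x = u * y) ∨ ∃ v, y = v * x := by
  rcases h (Ideal.span {x}) (Ideal.span {y}) with hle | hle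
  · obtain ⟨u, hu⟩ := Ideal.mem_span_singleton'.1 (hle (Ideal.mem_span_singleton_self x))
    exact Or.inl ⟨u, hu.symm⟩
  · obtain ⟨u, hu⟩ := Ideal.mem_span_singleton'.1 (hle (Ideal.mem_span_singleton_self y))
    exact Or.inr ⟨u, hu.symm⟩

/-- The criterion consists of equations in existentially quantified elements, so solutions can be
chosen in each coordinate; in a uniserial factor `(r, s)` is `(1, 0)` or `(0, 1)`. -/
theorem IsProductOfLeftUniserialRings.isLeftDistributiveRing {A : Type*} [Ring A]
    (h : IsProductOfLeftUniserialRings A) : IsLeftDistributiveRing A := by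
  obtain ⟨ι, R, _, hR, ⟨e⟩⟩ := h
  apply isLeftDistributiveRing_of_forall
  intro x y
  have hi (i : ι) : ∃ r s u v : R i, r + s = 1 ∧ r * e x i = u * e y i ∧ s * e y i = v * e x i := by
    rcases (hR i).exists_mul_eq (e x i) (e y i) with ⟨u, hu⟩ | ⟨v, hv⟩
    · exact ⟨1, 0, u, 0, by simp, by rw [one_mul, ← hu], by simp⟩
    · exact ⟨0, 1, 0, v, by simp, by simp, by rw [one_mul, ← hv]⟩
  choose r s u v hrs hu hv using hi
  refine ⟨e.symm r, e.symm s, e.symm u, e.symm v, ?_, ?_, ?_⟩ <;> apply e.injective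
  · rw [map_add, e.apply_symm_apply, e.apply_symm_apply, map_one]
    exact funext hrs
  · simp only [map_mul, e.apply_symm_apply]
    exact funext hu
  · simp only [map_mul, e.apply_symm_apply]
    exact funext hv

/-! ### Decomposition into maximal chains -/

section ChainDecomposition

variable {k V : Type*} [Field k] [AddCommGroup V] [Module k V]
  {L R : Dual k V →ₗ[k] V →ₗ[k] V}

/-- A stable subspace whose stable subspaces form a chain. -/
def IsChainStable (L : Dual k V →ₗ[k] V →ₗ[k] V) (N : Submodule k V) : Prop :=
  IsStable L N ∧ ∀ x ∈ N, ∀ y ∈ N, x ∈ orbitSpan L y ∨ y ∈ orbitSpan L x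

theorem IsChainStable.mono {N P : Submodule k V} (hN : IsChainStable L N) (hP : IsStable L P)
    (h : P ≤ N) : IsChainStable L P :=
  ⟨hP, fun x hx y hy => hN.2 x (h hx) y (h hy)⟩

theorem IsChainStable.le_total {N P Q : Submodule k V} (hN : IsChainStable L N)
    (hP : IsStable L P) (hQ : IsStable L Q) (hPN : P ≤ N) (hQN : Q ≤ N) : P ≤ Q ∨ Q ≤ P := by
  by_contra! h
  obtain ⟨x, hxP, hxQ⟩ := SetLike.not_le_iff_exists.1 h.1
  obtain ⟨y, hyQ, hyP⟩ := SetLike.not_le_iff_exists.1 h.2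
  rcases hN.2 x (hPN hxP) y (hQN hyQ) with hx | hy
  · exact hxQ (hQ.orbitSpan_le hyQ hx)
  · exact hyP (hP.orbitSpan_le hxP hy)

theorem IsChainStable.exists_maximal {N : Submodule k V} (hN : IsChainStable L N) :
    ∃ M, N ≤ M ∧ Maximal (IsChainStable L) M := by
  refine zorn_le_nonempty₀ {M | IsChainStable L M} (fun c hc hchain y hy => ?_) N hN
  have hmem {x : V} : x ∈ sSup c ↔ ∃ M ∈ c, x ∈ M :=
    Submodule.mem_sSup_of_directed ⟨y, hy⟩ hchain.directedOn
  refine ⟨sSup c, ⟨?_, ?_⟩, fun z hz => le_sSup hz⟩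
  · intro f x hx
    obtain ⟨M, hM, hxM⟩ := hmem.1 hx
    exact hmem.2 ⟨M, hM, (hc hM).1 f x hxM⟩
  · intro x hx z hz
    obtain ⟨M, hM, hxM⟩ := hmem.1 hx
    obtain ⟨M', hM', hzM'⟩ := hmem.1 hz
    rcases hchain.total hM hM' with hle | hle
    · exact (hc hM').2 x (hle hxM) z hzM'
    · exact (hc hM).2 x hxM z (hle hzM')

namespace IsHitPair

/-- In a distributive lattice of stable subspaces, the comparison of two cyclic subspaces. -/
theorem exists_mem_orbitSpan (h : IsHitPair L R)
    (dist : ∀ a b c, IsStable L a → IsStable L b → IsStable L c →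
      a ⊓ (b ⊔ c) ≤ (a ⊓ b) ⊔ (a ⊓ c)) (x y : V) :
    ∃ t, L t y ∈ orbitSpan L x ∧ x - L t x ∈ orbitSpan L y := by
  -- Distributivity is applied to `x = y + (x - y)`; the component in the orbit of `x - y` supplies
  -- `t`.
  have hx : x ∈ orbitSpan L x ⊓ (orbitSpan L y ⊔ orbitSpan L (x - y)) := by
    refine ⟨h.self_mem_orbitSpan x, ?_⟩
    have := Submodule.add_mem_sup (h.self_mem_orbitSpan y) (h.self_mem_orbitSpan (x - y))
    rwa [add_sub_cancel] at this
  obtain ⟨u, hu, v, hv, huv⟩ := Submodule.mem_sup.1 (dist _ _ _ (h.isStable_orbitSpan x)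
    (h.isStable_orbitSpan y) (h.isStable_orbitSpan (x - y)) hx)
  obtain ⟨t, ht⟩ := mem_orbitSpan.1 hv.2
  rw [map_sub] at ht
  refine ⟨t, ?_, ?_⟩
  · have e : L t y = L t x - v := by rw [← ht]; abel
    rw [e]
    exact sub_mem ⟨t, rfl⟩ hv.1
  · have e : x - L t x = u - L t y := by
      rw [sub_eq_sub_iff_add_eq_add, ← eq_sub_iff_add_eq, add_sub_assoc, ht, huv]
    rw [e]
    exact sub_mem hu.2 ⟨t, rfl⟩

theorem orbitSpan_eq (h : IsHitPair L R) (h' : IsHitPair R L)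
    (hiff : ∀ N, IsStable L N ↔ IsStable R N) (x : V) : orbitSpan L x = orbitSpan R x :=
  le_antisymm (((hiff _).2 (h'.isStable_orbitSpan x)).orbitSpan_le (h'.self_mem_orbitSpan x))
    (((hiff _).1 (h.isStable_orbitSpan x)).orbitSpan_le (h.self_mem_orbitSpan x))

/-- `L f` commutes with `R`, so it carries the `R`-orbit of `x` onto that of `L f x`. Both are
`L`-orbits, the second lies in the first, and injectivity makes their dimensions equal. -/
theorem mem_orbitSpan_of_injective (h : IsHitPair L R) (h' : IsHitPair R L)
    (hiff : ∀ N, IsStable L N ↔ IsStable R N) {N : Submodule k V} (hN : IsStable L N)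
    {f : Dual k V} (hf : ∀ z ∈ N, L f z = 0 → z = 0) {x : V} (hx : x ∈ N) :
    x ∈ orbitSpan L (L f x) := by
  have := h.fin x
  have hfin : FiniteDimensional k (orbitSpan L x) := this
  have hmap : (orbitSpan L x).map (L f) = orbitSpan L (L f x) := by
    rw [h.orbitSpan_eq h' hiff, h.orbitSpan_eq h' hiff]
    ext z
    constructor
    · rintro ⟨_, ⟨g, rfl⟩, rfl⟩
      exact ⟨g, (h.comm f g x).symm⟩
    · rintro ⟨g, rfl⟩
      exact ⟨_, ⟨g, rfl⟩, h.comm f g x⟩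
  have hle : orbitSpan L (L f x) ≤ orbitSpan L x :=
    (h.isStable_orbitSpan x).orbitSpan_le ⟨f, rfl⟩
  have hinj : LinearMap.ker ((L f).domRestrict (orbitSpan L x)) = ⊥ := by
    rw [LinearMap.ker_eq_bot']
    intro z hz
    exact Subtype.ext (hf z (hN.orbitSpan_le hx z.2) hz)
  have hrank : finrank k (orbitSpan L (L f x)) = finrank k (orbitSpan L x) := by
    rw [← hmap, ← LinearMap.range_domRestrict]
    exact LinearMap.finrank_range_of_inj (LinearMap.ker_eq_bot.1 hinj)
  rw [Submodule.eq_of_le_of_finrank_eq hle hrank]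
  exact h.self_mem_orbitSpan x

/-- A finite dimensional indecomposable stable subspace is a chain, by Fitting's lemma. -/
theorem isChainStable_of_indecomposable (h : IsHitPair L R) (h' : IsHitPair R L)
    (dist : ∀ a b c, IsStable L a → IsStable L b → IsStable L c →
      a ⊓ (b ⊔ c) ≤ (a ⊓ b) ⊔ (a ⊓ c)) {N : Submodule k V} [FiniteDimensional k N]
    (hN : IsStable L N)
    (hind : ∀ P Q, IsStable L P → IsStable L Q → P ⊔ Q = N → P ⊓ Q = ⊥ → P = ⊥ ∨ Q = ⊥) :
    IsChainStable L N := by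
  have hiff := h.isStable_iff dist
  refine ⟨hN, fun x hx y hy => ?_⟩
  obtain ⟨t, hty, htx⟩ := h.exists_mem_orbitSpan dist x y
  let T : Module.End k N := (L t).restrict (hN t)
  -- Fitting decomposition of `N` under `L t`. Kernel and range are `R`-stable because `L t`
  -- commutes with `R`, hence `L`-stable. The bound `1 ≤ n` ensures that the kernel of `T ^ n`
  -- contains that of `T`.
  obtain ⟨n, hn, hn1⟩ := (T.eventually_isCompl_ker_pow_range_pow.and
    (Filter.eventually_ge_atTop 1)).exists
  have hNR := (hiff N).1 hN
  have hcomm (g : Dual k V) : Commute ((R g).restrict (hNR g)) (T ^ n) := by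
    refine Commute.pow_right ?_ n
    ext z
    exact (h.comm t g z).symm
  have hP : IsStable L ((LinearMap.ker (T ^ n)).map N.subtype) := by
    rw [hiff]
    rintro g _ ⟨z, hz, rfl⟩
    refine ⟨(R g).restrict (hNR g) z, ?_, rfl⟩
    have := LinearMap.congr_fun (hcomm g).eq z
    simp only [Module.End.mul_apply] at this
    rw [SetLike.mem_coe, LinearMap.mem_ker] at hz ⊢
    rw [← this, hz, map_zero]
  have hQ : IsStable L ((LinearMap.range (T ^ n)).map N.subtype) := by
    rw [hiff]
    rintro g _ ⟨_, ⟨z, rfl⟩, rfl⟩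
    exact ⟨(R g).restrict (hNR g) ((T ^ n) z), ⟨(R g).restrict (hNR g) z,
      (LinearMap.congr_fun (hcomm g).eq z).symm⟩, rfl⟩
  have hbot {U : Submodule k N} (hU : U.map N.subtype = ⊥) : U = ⊥ :=
    Submodule.map_injective_of_injective N.injective_subtype (hU.trans (Submodule.map_bot _).symm)
  rcases hind _ _ hP hQ (by rw [← Submodule.map_sup, hn.sup_eq_top, Submodule.map_subtype_top])
    (by rw [← Submodule.map_inf _ N.injective_subtype, hn.inf_eq_bot, Submodule.map_bot])
    with hker | hran
  · right
    refine (h.isStable_orbitSpan x).orbitSpan_le hty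
      (h.mem_orbitSpan_of_injective h' hiff hN (fun z hz htz => ?_) hy)
    have : (⟨z, hz⟩ : N) ∈ LinearMap.ker (T ^ n) := by
      rw [LinearMap.mem_ker]
      obtain ⟨m, rfl⟩ := Nat.exists_eq_succ_of_ne_zero (Nat.one_le_iff_ne_zero.1 hn1)
      have hz0 : T ⟨z, hz⟩ = 0 := Subtype.ext htz
      rw [pow_succ, Module.End.mul_apply, hz0, map_zero]
    rw [hbot hker, Submodule.mem_bot] at this
    exact congrArg Subtype.val this
  · left
    -- Here `T` is nilpotent, so `1 - T` is injective: a fixed vector of `T` would lie in the range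
    -- of `T ^ n`.
    obtain ⟨e, he⟩ := h.one
    have het (z : V) : L (e - t) z = z - L t z := by
      rw [map_sub, LinearMap.sub_apply, he]
    refine (h.isStable_orbitSpan y).orbitSpan_le htx ?_
    rw [← het]
    refine h.mem_orbitSpan_of_injective h' hiff hN (fun z hz htz => ?_) hx
    rw [het, sub_eq_zero] at htz
    have : (⟨z, hz⟩ : N) ∈ LinearMap.range (T ^ n) := by
      have hz1 : T ⟨z, hz⟩ = ⟨z, hz⟩ := Subtype.ext htz.symm
      refine ⟨⟨z, hz⟩, ?_⟩
      rw [Module.End.pow_apply]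
      exact Function.iterate_fixed hz1 n
    rw [hbot hran, Submodule.mem_bot] at this
    exact congrArg Subtype.val this

theorem isChainStable_sup_of_finiteDimensional (h : IsHitPair L R) (h' : IsHitPair R L)
    (dist : ∀ a b c, IsStable L a → IsStable L b → IsStable L c →
      a ⊓ (b ⊔ c) ≤ (a ⊓ b) ⊔ (a ⊓ c)) {M M' : Submodule k V} [FiniteDimensional k M]
    [FiniteDimensional k M'] (hM : IsChainStable L M) (hM' : IsChainStable L M')
    (hne : M ⊓ M' ≠ ⊥) : IsChainStable L (M ⊔ M') := by
  refine h.isChainStable_of_indecomposable h' dist (hM.1.sup hM'.1) fun P Q hP hQ hsup hinf => ?_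
  -- By distributivity `U` is the sum of its traces on `P` and `Q`, and in a chain one trace
  -- contains the other. As `M` and `M'` meet, both fall on the same side.
  have key (U : Submodule k V) (hU : IsChainStable L U) (hle : U ≤ P ⊔ Q) : U ≤ P ∨ U ≤ Q := by
    have h1 := dist U P Q hU.1 hP hQ
    rw [inf_eq_left.2 hle] at h1
    rcases hU.le_total (hU.1.inf hP) (hU.1.inf hQ) inf_le_left inf_le_left with h2 | h2
    · exact Or.inr (h1.trans ((sup_le h2 le_rfl).trans inf_le_right))
    · exact Or.inl (h1.trans ((sup_le le_rfl h2).trans inf_le_right))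
  rcases key M hM (hsup ▸ le_sup_left) with h1 | h1 <;>
    rcases key M' hM' (hsup ▸ le_sup_right) with h2 | h2
  · right
    rw [eq_bot_iff, ← hinf]
    exact le_inf (le_sup_right.trans (hsup.le.trans (sup_le h1 h2))) le_rfl
  · exact absurd (eq_bot_iff.2 ((inf_le_inf h1 h2).trans hinf.le)) hne
  · exact absurd (eq_bot_iff.2 ((inf_le_inf h1 h2).trans (inf_comm Q P ▸ hinf.le))) hne
  · left
    rw [eq_bot_iff, ← hinf]
    exact le_inf le_rfl (le_sup_left.trans (hsup.le.trans (sup_le h1 h2)))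

theorem isChainStable_sup (h : IsHitPair L R) (h' : IsHitPair R L)
    (dist : ∀ a b c, IsStable L a → IsStable L b → IsStable L c →
      a ⊓ (b ⊔ c) ≤ (a ⊓ b) ⊔ (a ⊓ c)) {N N' : Submodule k V}
    (hN : IsChainStable L N) (hN' : IsChainStable L N') (hne : N ⊓ N' ≠ ⊥) :
    IsChainStable L (N ⊔ N') := by
  refine ⟨hN.1.sup hN'.1, fun x hx y hy => ?_⟩
  obtain ⟨a, ha, a', ha', rfl⟩ := Submodule.mem_sup.1 hx
  obtain ⟨b, hb, b', hb', rfl⟩ := Submodule.mem_sup.1 hy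
  obtain ⟨z, hz, hz0⟩ := Submodule.exists_mem_ne_zero_of_ne_bot hne
  have hfin (v : V) : FiniteDimensional k (orbitSpan L v) := h.fin v
  -- Finite dimensional pieces reduce to the previous lemma; the orbit of `z` is included so that
  -- the pieces inside `N` and `N'` still meet.
  let U (p q : V) : Submodule k V := orbitSpan L p ⊔ orbitSpan L q ⊔ orbitSpan L z
  have hU {W : Submodule k V} (hW : IsChainStable L W) {p q : V} (hp : p ∈ W) (hq : q ∈ W)
      (hzW : z ∈ W) : IsChainStable L (U p q) :=
    hW.mono (((h.isStable_orbitSpan p).sup (h.isStable_orbitSpan q)).sup (h.isStable_orbitSpan z))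
      (sup_le (sup_le (hW.1.orbitSpan_le hp) (hW.1.orbitSpan_le hq)) (hW.1.orbitSpan_le hzW))
  have hp (p q : V) : p ∈ U p q :=
    Submodule.mem_sup_left (Submodule.mem_sup_left (h.self_mem_orbitSpan p))
  have hq (p q : V) : q ∈ U p q :=
    Submodule.mem_sup_left (Submodule.mem_sup_right (h.self_mem_orbitSpan q))
  have hzU (p q : V) : z ∈ U p q := Submodule.mem_sup_right (h.self_mem_orbitSpan z)
  have hUU := h.isChainStable_sup_of_finiteDimensional h' dist (hU hN ha hb hz.1)
    (hU hN' ha' hb' hz.2) ((Submodule.ne_bot_iff _).2 ⟨z, ⟨hzU _ _, hzU _ _⟩, hz0⟩)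
  exact hUU.2 _ (Submodule.add_mem_sup (hp a b) (hp a' b')) _
    (Submodule.add_mem_sup (hq a b) (hq a' b'))

/-- Induction on dimension: an indecomposable subspace is a chain and lies in a maximal one, while a
decomposable one is a sum of two smaller stable subspaces. -/
theorem le_iSup_maximal (h : IsHitPair L R) (h' : IsHitPair R L)
    (dist : ∀ a b c, IsStable L a → IsStable L b → IsStable L c →
      a ⊓ (b ⊔ c) ≤ (a ⊓ b) ⊔ (a ⊓ c)) (n : ℕ) :
    ∀ N : Submodule k V, FiniteDimensional k N → finrank k N = n → IsStable L N →
      N ≤ ⨆ M : {M // Maximal (IsChainStable L) M}, M.1 := by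
  induction n using Nat.strong_induction_on with
  | _ n ih =>
  intro N hfin hn hN
  by_cases hind : ∀ P Q, IsStable L P → IsStable L Q → P ⊔ Q = N → P ⊓ Q = ⊥ → P = ⊥ ∨ Q = ⊥
  · obtain ⟨M, hNM, hM⟩ := (h.isChainStable_of_indecomposable h' dist hN hind).exists_maximal
    exact hNM.trans (le_iSup (fun M : {M // Maximal (IsChainStable L) M} => M.1) ⟨M, hM⟩)
  push Not at hind
  obtain ⟨P, Q, hP, hQ, hsup, hinf, hP0, hQ0⟩ := hind
  have hPN : P < N := by
    refine lt_of_le_of_ne (hsup ▸ le_sup_left) fun e => hQ0 ?_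
    rw [eq_bot_iff, ← hinf]
    exact le_inf (e ▸ hsup ▸ le_sup_right) le_rfl
  have hQN : Q < N := by
    refine lt_of_le_of_ne (hsup ▸ le_sup_right) fun e => hP0 ?_
    rw [eq_bot_iff, ← hinf]
    exact le_inf le_rfl (e ▸ hsup ▸ le_sup_left)
  rw [← hsup]
  exact sup_le
    (ih _ (hn ▸ Submodule.finrank_lt_finrank_of_lt hPN) P
      (Submodule.finiteDimensional_of_le hPN.le) rfl hP)
    (ih _ (hn ▸ Submodule.finrank_lt_finrank_of_lt hQN) Q
      (Submodule.finiteDimensional_of_le hQN.le) rfl hQ)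

theorem iSup_maximal_eq_top (h : IsHitPair L R) (h' : IsHitPair R L)
    (dist : ∀ a b c, IsStable L a → IsStable L b → IsStable L c →
      a ⊓ (b ⊔ c) ≤ (a ⊓ b) ⊔ (a ⊓ c)) :
    ⨆ M : {M // Maximal (IsChainStable L) M}, M.1 = ⊤ := by
  rw [eq_top_iff]
  intro x _
  exact h.le_iSup_maximal h' dist _ _ (h.fin x) rfl (h.isStable_orbitSpan x)
    (h.self_mem_orbitSpan x)

/-- Two maximal chains that meet equal their sum, so distinct ones are disjoint. Distributivity
upgrades pairwise disjointness to independence, one summand at a time. -/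
theorem iSupIndep_maximal (h : IsHitPair L R) (h' : IsHitPair R L)
    (dist : ∀ a b c, IsStable L a → IsStable L b → IsStable L c →
      a ⊓ (b ⊔ c) ≤ (a ⊓ b) ⊔ (a ⊓ c)) :
    iSupIndep fun M : {M // Maximal (IsChainStable L) M} => M.1 := by
  classical
  have hpair (M M' : {M // Maximal (IsChainStable L) M}) (hne : M ≠ M') : M.1 ⊓ M'.1 = ⊥ := by
    by_contra hbot
    have hsup := h.isChainStable_sup h' dist M.2.1 M'.2.1 hbot
    exact hne (Subtype.ext ((M.2.eq_of_le hsup le_sup_left).trans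
      (M'.2.eq_of_le hsup le_sup_right).symm))
  rw [iSupIndep_iff_supIndep]
  intro s t _ i _ hit
  have hstable (u : Finset {M // Maximal (IsChainStable L) M}) :
      IsStable L (u.sup fun M => M.1) :=
    Finset.sup_induction IsStable.bot (fun _ ha _ hb => ha.sup hb) fun M _ => M.2.1.1
  rw [disjoint_iff]
  induction t using Finset.induction_on with
  | empty => simp
  | insert j t _ ih =>
    rw [Finset.mem_insert, not_or] at hit
    rw [Finset.sup_insert, eq_bot_iff]
    refine (dist _ _ _ i.2.1.1 j.2.1.1 (hstable t)).trans ?_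
    rw [hpair i j hit.1, ih (by grind) hit.2, sup_bot_eq]

end IsHitPair

end ChainDecomposition

/-! ### Two-sided coideals as coalgebras -/

section Subcoalgebra

variable {k : Type*} [Field k] {C : Type*} [AddCommGroup C] [Module k C] [Coalgebra k C]

/-- A linear retraction onto a subspace. -/
noncomputable def Submodule.retraction (N : Submodule k C) : C →ₗ[k] N :=
  (N.subtype.exists_leftInverse_of_injective N.ker_subtype).choose

omit [Coalgebra k C] in
theorem Submodule.retraction_comp_subtype (N : Submodule k C) :
    N.retraction ∘ₗ N.subtype = LinearMap.id :=
  (N.subtype.exists_leftInverse_of_injective N.ker_subtype).choose_spec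

/-- The restriction of the comultiplication to a subspace. -/
noncomputable def restrictComul (N : Submodule k C) : N →ₗ[k] N ⊗[k] N :=
  TensorProduct.map N.retraction N.retraction ∘ₗ Coalgebra.comul ∘ₗ N.subtype

/-- Composed with the inclusion, the retraction is a projection onto `N`. It fixes `Δ x` in the
first factor because `N` is a right coideal, and in the second because it is a left one. -/
theorem map_subtype_comp_restrictComul {N : Submodule k C} (hr : N ∈ rightCoideals k C)
    (hl : N ∈ leftCoideals k C) :
    TensorProduct.map N.subtype N.subtype ∘ₗ restrictComul N = Coalgebra.comul ∘ₗ N.subtype := by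
  ext x
  obtain ⟨y, hy⟩ := hr x x.2
  obtain ⟨z, hz⟩ := hl x x.2
  have h1 : (N.subtype ∘ₗ N.retraction).rTensor C (Coalgebra.comul (R := k) (x : C)) =
      Coalgebra.comul (R := k) (x : C) := by
    rw [← hy, ← LinearMap.comp_apply, ← LinearMap.rTensor_comp, LinearMap.comp_assoc,
      N.retraction_comp_subtype, LinearMap.comp_id]
  have h2 : (N.subtype ∘ₗ N.retraction).lTensor C (Coalgebra.comul (R := k) (x : C)) =
      Coalgebra.comul (R := k) (x : C) := by
    rw [← hz, ← LinearMap.comp_apply, ← LinearMap.lTensor_comp, LinearMap.comp_assoc,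
      N.retraction_comp_subtype, LinearMap.comp_id]
  simp only [restrictComul, LinearMap.comp_apply, Submodule.subtype_apply]
  rw [← LinearMap.comp_apply, ← TensorProduct.map_comp, ← LinearMap.rTensor_comp_lTensor,
    LinearMap.comp_apply, h2, h1]

/-- A two-sided coideal is a coalgebra. -/
noncomputable abbrev subcoalgebra (N : Submodule k C) (hr : N ∈ rightCoideals k C)
    (hl : N ∈ leftCoideals k C) : Coalgebra k N where
  comul := restrictComul N
  counit := Coalgebra.counit ∘ₗ N.subtype
  coassoc := by
    have hδ := map_subtype_comp_restrictComul hr hl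
    have hinj : Function.Injective
        (TensorProduct.map N.subtype (TensorProduct.map N.subtype N.subtype)) := by
      refine Function.LeftInverse.injective (g := TensorProduct.map N.retraction
        (TensorProduct.map N.retraction N.retraction)) fun x => ?_
      rw [← LinearMap.comp_apply, ← TensorProduct.map_comp, ← TensorProduct.map_comp,
        N.retraction_comp_subtype, TensorProduct.map_id, TensorProduct.map_id, LinearMap.id_apply]
    rw [← LinearMap.cancel_left hinj]
    have e1 : TensorProduct.map N.subtype (TensorProduct.map N.subtype N.subtype) ∘ₗ
        (TensorProduct.assoc k N N N).toLinearMap =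
        (TensorProduct.assoc k C C C).toLinearMap ∘ₗ
          TensorProduct.map (TensorProduct.map N.subtype N.subtype) N.subtype :=
      TensorProduct.map_map_comp_assoc_eq _ _ _
    calc _ = (TensorProduct.assoc k C C C).toLinearMap ∘ₗ
          (TensorProduct.map (TensorProduct.map N.subtype N.subtype) N.subtype ∘ₗ
            (restrictComul N).rTensor N) ∘ₗ restrictComul N := by
          rw [← LinearMap.comp_assoc, e1]; rfl
      _ = (TensorProduct.assoc k C C C).toLinearMap ∘ₗ
          (Coalgebra.comul (R := k) (A := C)).rTensor C ∘ₗ Coalgebra.comul ∘ₗ N.subtype := by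
          rw [LinearMap.map_comp_rTensor, hδ, ← LinearMap.rTensor_comp_map, LinearMap.comp_assoc,
            hδ]
      _ = (Coalgebra.comul (R := k) (A := C)).lTensor C ∘ₗ Coalgebra.comul ∘ₗ N.subtype := by
          exact congrArg (· ∘ₗ N.subtype) Coalgebra.coassoc
      _ = _ := by
          rw [← LinearMap.comp_assoc (restrictComul N), LinearMap.map_comp_lTensor, hδ,
            ← LinearMap.lTensor_comp_map, LinearMap.comp_assoc, hδ]
  rTensor_counit_comp_comul := by
    have hδ := map_subtype_comp_restrictComul hr hl
    rw [← LinearMap.cancel_left (Module.Flat.lTensor_preserves_injective_linearMap (M := k)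
      N.subtype N.injective_subtype), ← LinearMap.comp_assoc, LinearMap.lTensor_comp_rTensor,
      ← LinearMap.rTensor_comp_map, LinearMap.comp_assoc, hδ, ← LinearMap.comp_assoc,
      Coalgebra.rTensor_counit_comp_comul]
    rfl
  lTensor_counit_comp_comul := by
    have hδ := map_subtype_comp_restrictComul hr hl
    rw [← LinearMap.cancel_left (Module.Flat.rTensor_preserves_injective_linearMap (M := k)
      N.subtype N.injective_subtype), ← LinearMap.comp_assoc, LinearMap.rTensor_comp_lTensor,
      ← LinearMap.lTensor_comp_map, LinearMap.comp_assoc, hδ, ← LinearMap.comp_assoc,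
      Coalgebra.lTensor_counit_comp_comul]
    rfl

/-- The pullback of linear forms along a coalgebra homomorphism. -/
def dualAlgebraMap {D : Type*} [AddCommGroup D] [Module k D] [Coalgebra k D] (φ : D →ₗc[k] C) :
    DualAlgebra k C →+* DualAlgebra k D where
  toFun f := WithConv.toConv (f.ofConv ∘ₗ φ.toLinearMap)
  map_one' := congrArg WithConv.toConv φ.counit_comp
  map_mul' f g := congrArg WithConv.toConv (LinearMap.convMul_comp_coalgHom_distrib f g φ)
  map_zero' := rfl
  map_add' _ _ := rfl

theorem hitL_coalgHom {D : Type*} [AddCommGroup D] [Module k D] [Coalgebra k D] (φ : D →ₗc[k] C)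
    (f : Dual k C) (x : D) :
    hitL k C f (φ x) = φ (hitL k D (f ∘ₗ φ.toLinearMap) x) := by
  refine eq_of_forall_dual (k := k) fun g => ?_
  rw [apply_hitL]
  refine Eq.trans ?_ (apply_hitL (f ∘ₗ φ.toLinearMap) (g ∘ₗ φ.toLinearMap) x).symm
  exact congrArg (fun l : DualAlgebra k D => l x)
    (map_mul (dualAlgebraMap φ) (WithConv.toConv g) (WithConv.toConv f))

/-- Every form on `C` pulls back to `D`, so the image of a right coideal of `D` is a right coideal
of `C`, and comparability can be tested inside `C`. -/
theorem isRightChainCoalgebra_of_injective {D : Type*} [AddCommGroup D] [Module k D]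
    [Coalgebra k D] (φ : D →ₗc[k] C) (hφ : Function.Injective φ)
    (h : ∀ P Q : Submodule k C, P ∈ rightCoideals k C → Q ∈ rightCoideals k C →
      P ≤ LinearMap.range φ.toLinearMap → Q ≤ LinearMap.range φ.toLinearMap → P ≤ Q ∨ Q ≤ P) :
    IsRightChainCoalgebra k D := by
  have hmap {P : Submodule k D} (hP : P ∈ rightCoideals k D) :
      P.map φ.toLinearMap ∈ rightCoideals k C := by
    rw [mem_rightCoideals_iff] at hP ⊢
    rintro f _ ⟨x, hx, rfl⟩
    exact ⟨_, hP (f ∘ₗ φ.toLinearMap) x hx, (hitL_coalgHom φ f x).symm⟩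
  rintro ⟨P, hP⟩ ⟨Q, hQ⟩
  have hle {P Q : Submodule k D} (h : P.map φ.toLinearMap ≤ Q.map φ.toLinearMap) : P ≤ Q :=
    (Submodule.map_le_map_iff_of_injective hφ P Q).1 h
  exact (h _ _ (hmap hP) (hmap hQ) LinearMap.map_le_range LinearMap.map_le_range).imp hle hle

/-- The inclusion of a summand in a coproduct of coalgebras. -/
noncomputable def DFinsupp.singleCoalgHom {ι : Type*} [DecidableEq ι] {D : ι → Type*}
    [∀ i, AddCommGroup (D i)] [∀ i, Module k (D i)] [∀ i, Coalgebra k (D i)] (i : ι) :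
    D i →ₗc[k] Π₀ i, D i where
  toLinearMap := DFinsupp.lsingle i
  counit_comp := DFinsupp.counit_comp_lsingle k ι D i
  map_comp_comul := (DFinsupp.comul_comp_lsingle k ι D i).symm

end Subcoalgebra

/-! ### Coproduct decompositions and the equivalences -/

theorem IsCoproductOfRightChainCoalgebras.isProductOfLeftUniserialRings {k : Type u} [Field k]
    {C : Type v} [AddCommGroup C] [Module k C] [Coalgebra k C]
    (h : IsCoproductOfRightChainCoalgebras k C) :
    IsProductOfLeftUniserialRings (DualAlgebra k C) := by
  obtain ⟨ι, _, D, _, _, _, hD, ⟨e⟩⟩ := h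
  refine ⟨ULift.{u} ι, fun i => DualAlgebra k (D i.down), fun _ => inferInstance,
    fun i => isLeftUniserialRing_dualAlgebra (hD i.down), ⟨RingEquiv.ofBijective
      (RingHom.pi fun i : ULift.{u} ι => dualAlgebraMap
        ((e.symm : (Π₀ i, D i) →ₗc[k] C).comp (DFinsupp.singleCoalgHom i.down))) ⟨?_, ?_⟩⟩⟩
  · rw [injective_iff_map_eq_zero]
    intro f hf
    have h0 : f.ofConv ∘ₗ (e.symm : (Π₀ i, D i) →ₗc[k] C).toLinearMap = 0 := by
      refine DFinsupp.lhom_ext fun i x => ?_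
      have := congrFun hf ⟨i⟩
      exact LinearMap.congr_fun (congrArg WithConv.ofConv this) x
    refine WithConv.ext (LinearMap.ext fun x => ?_)
    have := LinearMap.congr_fun h0 (e x)
    simpa using this
  · intro F
    refine ⟨WithConv.toConv ((DFinsupp.lsum k fun i => (F ⟨i⟩).ofConv) ∘ₗ
      (e : C →ₗc[k] Π₀ i, D i).toLinearMap), ?_⟩
    funext i
    refine WithConv.ext (LinearMap.ext fun x => ?_)
    change (DFinsupp.lsum k fun i => (F ⟨i⟩).ofConv) (e (e.symm (DFinsupp.single i.down x))) = _
    rw [CoalgEquiv.apply_symm_apply]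
    exact DFinsupp.lsum_single _ _ _ _

theorem IsRightDistributiveCoalgebra.isCoproductOfRightChainCoalgebras {k : Type*} [Field k]
    {C : Type*} [AddCommGroup C] [Module k C] [Coalgebra k C]
    (h : IsRightDistributiveCoalgebra k C) : IsCoproductOfRightChainCoalgebras k C := by
  classical
  have dist : ∀ a b c, IsStable (hitL k C) a → IsStable (hitL k C) b → IsStable (hitL k C) c →
      a ⊓ (b ⊔ c) ≤ (a ⊓ b) ⊔ (a ⊓ c) := by
    intro a b c ha hb hc
    rw [← mem_rightCoideals_iff] at ha hb hc
    exact isDistributiveLattice_sublattice_iff.1 h a b c ha hb hc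
  let p : {M // Maximal (IsChainStable (hitL k C)) M} → Submodule k C := fun M => M.1
  have hind : iSupIndep p :=
    (isHitPair_hitL_hitR k C).iSupIndep_maximal (isHitPair_hitR_hitL k C) dist
  have htop : ⨆ i, p i = ⊤ :=
    (isHitPair_hitL_hitR k C).iSup_maximal_eq_top (isHitPair_hitR_hitL k C) dist
  have hr (i) : p i ∈ rightCoideals k C := mem_rightCoideals_iff.2 i.2.1.1
  have hl (i) : p i ∈ leftCoideals k C := leftCoideals_eq_rightCoideals_of_right h ▸ hr i
  let _ : ∀ i, Coalgebra k (p i) := fun i => subcoalgebra (p i) (hr i) (hl i)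
  let φ : ∀ i, p i →ₗc[k] C := fun i =>
    { toLinearMap := (p i).subtype
      counit_comp := rfl
      map_comp_comul := map_subtype_comp_restrictComul (hr i) (hl i) }
  refine ⟨_, inferInstance, fun i => p i, inferInstance, inferInstance, inferInstance,
    fun i => ?_, ⟨CoalgEquiv.symm { hind.linearEquiv htop with
      counit_comp := ?_
      map_comp_comul := ?_ }⟩⟩
  · refine isRightChainCoalgebra_of_injective (φ i) (p i).injective_subtype fun P Q hP hQ hPi hQi =>
      i.2.1.le_total (mem_rightCoideals_iff.1 hP) (mem_rightCoideals_iff.1 hQ) ?_ ?_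
    · exact hPi.trans (Submodule.range_subtype _).le
    · exact hQi.trans (Submodule.range_subtype _).le
  · refine DFinsupp.lhom_ext fun i x => ?_
    change Coalgebra.counit (DFinsupp.lsum ℕ (fun i => (p i).subtype) (DFinsupp.single i x)) = _
    rw [DFinsupp.lsum_single, DFinsupp.counit_single]
    rfl
  · refine DFinsupp.lhom_ext fun i x => ?_
    -- On each summand the isomorphism is the inclusion, which is already a coalgebra map.
    have hsingle : (hind.linearEquiv htop).toLinearMap ∘ₗ DFinsupp.lsingle i = (p i).subtype :=
      LinearMap.ext fun y => DFinsupp.lsum_single ℕ (fun i => (p i).subtype) i y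
    change TensorProduct.map (hind.linearEquiv htop).toLinearMap (hind.linearEquiv htop).toLinearMap
      (Coalgebra.comul (DFinsupp.single i x)) =
      Coalgebra.comul (((hind.linearEquiv htop).toLinearMap ∘ₗ DFinsupp.lsingle i) x)
    rw [DFinsupp.comul_single, ← LinearMap.comp_apply, ← TensorProduct.map_comp, hsingle]
    exact LinearMap.congr_fun (φ i).map_comp_comul x

theorem mainTheorem1 (k : Type*) [Field k] (C : Type*) [AddCommGroup C] [Module k C]
    [Coalgebra k C] :
    (IsRightDistributiveCoalgebra k C ↔ IsLeftDistributiveCoalgebra k C) ∧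
    List.TFAE [
      IsDistributiveCoalgebra k C,
      IsCoproductOfRightChainCoalgebras k C,
      IsProductOfLeftUniserialRings (DualAlgebra k C),
      IsLeftDistributiveRing (DualAlgebra k C)] := by
  have hlr := isRightDistributiveCoalgebra_iff_isLeftDistributiveCoalgebra k C
  refine ⟨hlr, ?_⟩
  tfae_have 1 → 2 := fun h =>
    (h.elim id hlr.2).isCoproductOfRightChainCoalgebras
  tfae_have 2 → 3 := fun h => h.isProductOfLeftUniserialRings
  tfae_have 3 → 4 := fun h => h.isLeftDistributiveRing
  tfae_have 4 → 1 := fun h => Or.inr (isLeftDistributiveCoalgebra_of_dualAlgebra h)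
  tfae_finish
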